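/- Let $d\in\mathbb N$ and let $\omega:[0,\infty)\to[0,\infty)$ be a non-quasianalytic weight function, i.e. $\omega$ is continuous and increasing (in the weak sense) and - $(\alpha)$ there is $L\ge 1$ such that $\omega(2t)\le L(\omega(t)+1)$ for all $t\ge0$; - $(\beta)$ $\int_1^{\infty}\omega(t)t^{-2}\,dt<\infty$; - $(\gamma)$ there are $a\in\mathbb R$, $b>0$ such that $\omega(t)\ge a+b\log(1+t)$ for all $t\ge0$; - $(\delta)$ $t\mapsto\omega(e^t)$ is convex on $\mathbb R$. For $x\in\mathbb R^d$ put $\omega(x):=\omega(|x|)$, with $|\cdot|$ the Euclidean norm, and let $|\cdot|_\infty$ be the sup norm on $\mathbb R^d$. Let $\hat u(\xi)=\int_{\mathbb R^d}u(x)e^{-i\langle x,\xi\rangle}dx$, and let $\mathcal S_\omega(\mathbb R^d)$ be the set of all $u\in L^1(\mathbb R^d)$ with $u,\hat u\in C^\infty(\mathbb R^d)$ such that for all $\lambda>0$ and all multi-indices $\alpha\in\mathbb N_0^d$ $$\sup_{x\in\mathbb R^d}e^{\lambda\omega(x)}|D^\alpha u(x)|<\infty,\qquad \sup_{\xi\in\mathbb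 R^d}e^{\lambda\omega(\xi)}|D^\alpha\hat u(\xi)|<\infty,$$ where $D^\alpha=D_1^{\alpha_1}\cdots D_d^{\alpha_d}$, $D_j=-i\partial_{x_j}$. For $f,\psi\in\mathcal S_\omega(\mathbb R^d)$ let $$V_\psi f(x,\xi)=\int_{\mathbb R^d}f(y)\overline{\psi(y-x)}e^{-i\langle y,\xi\rangle}dy,\qquad x,\xi\in\mathbb R^d.$$ For $p,q\in[1,\infty]$ let $$\|F\|_{L^{p,q}}=\Big(\int_{\mathbb R^d}\Big(\int_{\mathbb R^d}|F(x,\xi)|^p\,dx\Big)^{q/p}d\xi\Big)^{1/q}\in[0,\infty],$$ with the $L^p$ or $L^q$ norm replaced by the essential supremum if $p=\infty$ or $q=\infty$. For a function $g$ on $\mathbb R^d$ let $R_g=\sup\{|x|_\infty:\ x\in\operatorname{supp}g\}\in[0,\infty]$ (with $R_g=0$ if $g=0$). Then for all $f,\psi\in\mathcal S_\omega(\mathbb R^d)$, all $p,q\in[1,\infty]$ and all $\lambda,\mu\ge0$, $$\limsup_{N\to+\infty}\Big\|e^{\lambda\omega\left(\frac{x}{N+1}\right)+\mu\omega(\xi)}\,|\xi|_\infty^N\,V_\psi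 f(x,\xi)\Big\|_{L^{p,q}}^{1/N}\le R_{\hat f}+R_{\hat\psi}.$$ -/

import Mathlib

open MeasureTheory Filter
open scoped ENNReal

noncomputable section

namespace RealPaleyWiener

/-- Non-quasianalytic weight functions `ω : [0, ∞) → [0, ∞)`. Only the values of `ω` on `[0, ∞)`
matter; "increasing" is meant in the weak sense. -/
structure IsWeight (ω : ℝ → ℝ) : Prop where
  continuousOn : ContinuousOn ω (Set.Ici 0)
  monotoneOn : MonotoneOn ω (Set.Ici 0)
  nonneg : ∀ t, 0 ≤ t → 0 ≤ ω t
  /-- condition (α) -/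
  doubling : ∃ L : ℝ, 1 ≤ L ∧ ∀ t, 0 ≤ t → ω (2 * t) ≤ L * (ω t + 1)
  /-- condition (β) -/
  integrable : IntegrableOn (fun t => ω t / t ^ 2) (Set.Ioi 1) volume
  /-- condition (γ) -/
  log_le : ∃ a b : ℝ, 0 < b ∧ ∀ t, 0 ≤ t → a + b * Real.log (1 + t) ≤ ω t
  /-- condition (δ) -/
  convex : ConvexOn ℝ Set.univ (fun t : ℝ => ω (Real.exp t))

/-- `ℝ^d` with its Euclidean norm, standard inner product and Lebesgue measure. -/
abbrev E (d : ℕ) : Type := EuclideanSpace ℝ (Fin d)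

variable {d : ℕ}

/-- The sup norm `|ξ|_∞` of a vector of `ℝ^d`. -/
def supNorm (ξ : E d) : ℝ := ‖(WithLp.ofLp ξ : Fin d → ℝ)‖

/-- The Fourier transform `û(ξ) = ∫ u(x) e^{-i⟨x, ξ⟩} dx`. -/
def fourier (u : E d → ℂ) (ξ : E d) : ℂ :=
  ∫ x : E d, u x * Complex.exp (-(Complex.I * ((inner ℝ x ξ : ℝ) : ℂ)))

/-- The short-time Fourier (Gabor) transform of `u` with window `ψ`,
`V_ψ u (x, ξ) = ∫ u(y) conj(ψ(y - x)) e^{-i⟨y, ξ⟩} dy`. -/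
def gabor (ψ u : E d → ℂ) (x ξ : E d) : ℂ :=
  ∫ y : E d, u y * (starRingEnd ℂ) (ψ (y - x)) *
    Complex.exp (-(Complex.I * ((inner ℝ y ξ : ℝ) : ℂ)))

/-- The operator `D_j = -i ∂/∂x_j`. -/
def partialD (j : Fin d) (u : E d → ℂ) : E d → ℂ :=
  fun x => -Complex.I * fderiv ℝ u x (EuclideanSpace.single j (1 : ℝ))

/-- `D^α = D_1^{α_1} ⋯ D_d^{α_d}` for a multi-index `α`. -/
def multiD (α : Fin d → ℕ) (u : E d → ℂ) : E d → ℂ :=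
  (List.finRange d).foldr (fun j g => (partialD j)^[α j] g) u

/-- The space `S_ω(ℝ^d)`: all `u ∈ L¹` such that `u` and `û` are smooth and, for all `l > 0` and all
multi-indices `α`, the functions `e^{l ω(x)} |D^α u(x)|` and `e^{l ω(ξ)} |D^α û(ξ)|` are bounded. -/
def SOmega (ω : ℝ → ℝ) (d : ℕ) : Set (E d → ℂ) :=
  {u | Integrable u volume ∧ ContDiff ℝ (⊤ : ℕ∞) u ∧ ContDiff ℝ (⊤ : ℕ∞) (fourier u) ∧
    ∀ l : ℝ, 0 < l → ∀ α : Fin d → ℕ,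
      (∃ C : ℝ, ∀ x : E d, Real.exp (l * ω ‖x‖) * ‖multiD α u x‖ ≤ C) ∧
      (∃ C : ℝ, ∀ ξ : E d, Real.exp (l * ω ‖ξ‖) * ‖multiD α (fourier u) ξ‖ ≤ C)}

/-- The mixed norm `‖F‖_{L^{p,q}}` (the `L^p` norm in the first variable, then the `L^q` norm in the
second), with values in `[0, ∞]`; an infinite exponent stands for an essential supremum. -/
def mixedNorm (p q : ℝ≥0∞) (F : E d → E d → ℂ) : ℝ≥0∞ :=
  eLpNorm (fun ξ : E d => eLpNorm (fun x : E d => F x ξ) p volume) q volume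

/-- `R_g = sup {|x|_∞ : x ∈ supp g} ∈ [0, ∞]`, which is `0` if `g = 0`. -/
def supportRadius (g : E d → ℂ) : ℝ≥0∞ :=
  ⨆ x ∈ tsupport g, ENNReal.ofReal (supNorm x)

end RealPaleyWiener

end

namespace RealPaleyWiener

open scoped FourierTransform RealInnerProductSpace

/-! If `R = R_f̂ + R_ψ̂` is infinite there is nothing to prove. Otherwise, on the Fourier side, `V_ψ
f(x, ξ)` is an integral over `η` of `f̂(η)` times the conjugate of `ψ̂(η - ξ)` and a phase, so it
vanishes unless `|ξ|_∞ ≤ R` (`ofReal_supNorm_le_of_gabor_ne_zero`). There `|ξ|_∞^N ≤ R^N` and the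
frequency weight is bounded. Since `ω` is increasing, the weight at `x/(N+1)` is at most the one at
`x`, which the decay of `V_ψ f` in `x` absorbs (`exists_norm_gabor_le`). The mixed norm is thus at
most `R^N` times a finite constant independent of `N`, and the `N`-th root removes the constant. -/

/-! ### An integrable profile lying in every `L^p`. -/

/-- The integrable decay function `(1 + |x|)^{-(d + 1)}`. -/
noncomputable def polyDecay {d : ℕ} (x : E d) : ℝ := (1 + ‖x‖) ^ (-((d : ℝ) + 1))

lemma polyDecay_pos {d : ℕ} (x : E d) : 0 < polyDecay x := by
  unfold polyDecay; positivity

lemma polyDecay_le_one {d : ℕ} (x : E d) : polyDecay x ≤ 1 :=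
  Real.rpow_le_one_of_one_le_of_nonpos (by linarith [norm_nonneg x])
    (by linarith [d.cast_nonneg (α := ℝ)])

lemma integrable_polyDecay {d : ℕ} : Integrable (polyDecay (d := d)) volume :=
  integrable_one_add_norm (by simp)

lemma memLp_polyDecay {d : ℕ} {p : ℝ≥0∞} (hp : 1 ≤ p) :
    MemLp (polyDecay (d := d)) p volume := by
  have hmeas : AEStronglyMeasurable (polyDecay (d := d)) volume :=
    integrable_polyDecay.aestronglyMeasurable
  rcases eq_or_ne p ∞ with rfl | hp'
  · refine memLp_top_of_bound hmeas 1 (Eventually.of_forall fun x => ?_)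
    rw [Real.norm_of_nonneg (polyDecay_pos x).le]
    exact polyDecay_le_one x
  · have hp0 : p ≠ 0 := (zero_lt_one.trans_le hp).ne'
    rw [← integrable_norm_rpow_iff hmeas hp0 hp']
    have h1 : 1 ≤ p.toReal := by
      simpa using ENNReal.toReal_mono hp' hp
    have h2 : (Module.finrank ℝ (E d) : ℝ) < ((d : ℝ) + 1) * p.toReal := by
      rw [finrank_euclideanSpace_fin]
      nlinarith [d.cast_nonneg (α := ℝ)]
    refine (integrable_one_add_norm (μ := volume) h2).congr (Eventually.of_forall fun x => ?_)
    simp only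
    rw [Real.norm_of_nonneg (polyDecay_pos x).le, polyDecay, ← Real.rpow_mul (by positivity)]
    congr 1
    ring

lemma one_le_mul_polyDecay {d : ℕ} {r : ℝ} {x : E d} (hx : ‖x‖ ≤ r) :
    1 ≤ (1 + r) ^ ((d : ℝ) + 1) * polyDecay x := by
  rw [polyDecay, Real.rpow_neg (by positivity), ← div_eq_mul_inv, one_le_div (by positivity)]
  exact Real.rpow_le_rpow (by positivity) (by linarith) (by positivity)

/-! ### Consequences of the weight conditions. -/

namespace IsWeight

variable {ω : ℝ → ℝ}

lemma exists_exp_neg_mul_le_polyDecay (hω : IsWeight ω) (d : ℕ) :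
    ∃ s C : ℝ, 0 < s ∧ 0 ≤ C ∧ ∀ x : E d, Real.exp (-(s * ω ‖x‖)) ≤ C * polyDecay x := by
  obtain ⟨a, b, hb, h⟩ := hω.log_le
  -- By (γ), `e^{-sω(x)} ≤ e^{-sa} (1 + |x|)^{-sb}`; `s` is chosen so that `sb = d + 1`.
  refine ⟨((d : ℝ) + 1) / b, Real.exp (-(((d : ℝ) + 1) / b * a)), by positivity,
    (Real.exp_pos _).le, fun x => ?_⟩
  rw [polyDecay, Real.rpow_def_of_pos (by positivity), ← Real.exp_add, Real.exp_le_exp]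
  have h1 := mul_le_mul_of_nonneg_left (h ‖x‖ (norm_nonneg x))
    (by positivity : 0 ≤ ((d : ℝ) + 1) / b)
  have h2 : ((d : ℝ) + 1) / b * (b * Real.log (1 + ‖x‖))
      = ((d : ℝ) + 1) * Real.log (1 + ‖x‖) := by
    field_simp
  rw [mul_add, h2] at h1
  linarith

lemma exists_le_add (hω : IsWeight ω) (d : ℕ) :
    ∃ L : ℝ, 1 ≤ L ∧ ∀ x y : E d,
      ω ‖x‖ ≤ L * (ω ‖y‖ + ω ‖y - x‖ + 1) := by
  obtain ⟨L, hL, h⟩ := hω.doubling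
  refine ⟨L, hL, fun x y => ?_⟩
  have hx : ‖x‖ ≤ ‖y‖ + ‖y - x‖ := by
    simpa using norm_sub_le y (y - x)
  have hy := hω.nonneg _ (norm_nonneg y)
  have hyx := hω.nonneg _ (norm_nonneg (y - x))
  -- Used with `t` the larger of `|y|` and `|y - x|`, so that (α) applies to `|x| ≤ 2t`.
  have key : ∀ t, 0 ≤ t → ‖x‖ ≤ 2 * t → ω t ≤ ω ‖y‖ + ω ‖y - x‖ →
      ω ‖x‖ ≤ L * (ω ‖y‖ + ω ‖y - x‖ + 1) := fun t ht hxt hωt =>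
    (hω.monotoneOn (norm_nonneg x) (Set.mem_Ici.2 (by linarith)) hxt).trans
      ((h t ht).trans (mul_le_mul_of_nonneg_left (by linarith) (by linarith)))
  rcases le_total ‖y‖ ‖y - x‖ with hle | hle
  · exact key ‖y - x‖ (norm_nonneg _) (by linarith) (by linarith)
  · exact key ‖y‖ (norm_nonneg _) (by linarith) (by linarith)

end IsWeight

/-! ### Decay of functions in `SOmega` and of their transforms. -/

variable {d : ℕ} {ω : ℝ → ℝ}

lemma multiD_zero (u : E d → ℂ) : multiD 0 u = u := by
  simp [multiD]

lemma exists_le_exp_mul_polyDecay (hω : IsWeight ω) {u : E d → ℂ}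
    (hu : ∀ l : ℝ, 0 < l → ∃ C : ℝ, ∀ x, Real.exp (l * ω ‖x‖) * ‖u x‖ ≤ C)
    {k : ℝ} (hk : 0 ≤ k) :
    ∃ C : ℝ, 0 ≤ C ∧ ∀ x, ‖u x‖ ≤ C * (Real.exp (-(k * ω ‖x‖)) * polyDecay x) := by
  obtain ⟨s, K, hs, hK, hsK⟩ := hω.exists_exp_neg_mul_le_polyDecay d
  -- The surplus `s` in the exponent pays for the factor `polyDecay`.
  obtain ⟨C, hC⟩ := hu (k + s) (by positivity)
  have hC0 : 0 ≤ C := le_trans (by positivity) (hC 0)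
  refine ⟨C * K, by positivity, fun x => ?_⟩
  have h1 : ‖u x‖ = (Real.exp ((k + s) * ω ‖x‖) * ‖u x‖)
      * (Real.exp (-(k * ω ‖x‖)) * Real.exp (-(s * ω ‖x‖))) := by
    have : Real.exp ((k + s) * ω ‖x‖) * (Real.exp (-(k * ω ‖x‖)) * Real.exp (-(s * ω ‖x‖))) = 1 := by
      rw [← Real.exp_add, ← Real.exp_add, Real.exp_eq_one_iff]; ring
    rw [mul_right_comm, this, one_mul]
  calc ‖u x‖ = _ := h1
    _ ≤ C * (Real.exp (-(k * ω ‖x‖)) * (K * polyDecay x)) :=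
      mul_le_mul (hC x) (mul_le_mul_of_nonneg_left (hsK x) (Real.exp_pos _).le)
        (by positivity) hC0
    _ = _ := by ring

namespace SOmega

variable {u : E d → ℂ}

lemma exists_norm_le (hω : IsWeight ω) (hu : u ∈ SOmega ω d) {k : ℝ} (hk : 0 ≤ k) :
    ∃ C : ℝ, 0 ≤ C ∧ ∀ x, ‖u x‖ ≤ C * (Real.exp (-(k * ω ‖x‖)) * polyDecay x) :=
  exists_le_exp_mul_polyDecay hω
    (fun l hl => by simpa only [multiD_zero] using (hu.2.2.2 l hl 0).1) hk

lemma exists_norm_fourier_le (hω : IsWeight ω) (hu : u ∈ SOmega ω d) {k : ℝ} (hk : 0 ≤ k) :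
    ∃ C : ℝ, 0 ≤ C ∧ ∀ x, ‖fourier u x‖ ≤ C * (Real.exp (-(k * ω ‖x‖)) * polyDecay x) :=
  exists_le_exp_mul_polyDecay hω
    (fun l hl => by simpa only [multiD_zero] using (hu.2.2.2 l hl 0).2) hk

lemma integrable_fourier (hω : IsWeight ω) (hu : u ∈ SOmega ω d) :
    Integrable (fourier u) volume := by
  obtain ⟨C, -, hC⟩ := exists_norm_fourier_le hω hu le_rfl
  refine (integrable_polyDecay.const_mul C).mono' hu.2.2.1.continuous.aestronglyMeasurable
    (Eventually.of_forall fun x => ?_)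
  simpa using hC x

end SOmega

/-! ### The Gabor transform on the Fourier side. -/

/-- Mathlib's Fourier transform in terms of the transform with angular frequencies. -/
lemma fourierTransform_eq_fourier (u : E d → ℂ) (w : E d) :
    𝓕 u w = fourier u ((2 * Real.pi) • w) := by
  rw [Real.fourier_eq', fourier]
  refine integral_congr_ae (Eventually.of_forall fun y => ?_)
  simp only [smul_eq_mul, inner_smul_right]
  rw [mul_comm]
  congr 2
  push_cast
  ring

/-- Fourier inversion, with the variable kept as `w = η / 2π` so that no factor `(2π)^{-d}` appears.
-/
lemma integral_fourier_mul_exp (u : E d → ℂ) (hc : Continuous u) (hi : Integrable u volume)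
    (hF : Integrable (fourier u) volume) (y : E d) :
    u y = ∫ w : E d, fourier u ((2 * Real.pi) • w) *
      Complex.exp (Complex.I * ((inner ℝ y ((2 * Real.pi) • w) : ℝ) : ℂ)) := by
  have hF' : Integrable (𝓕 u) volume := by
    rw [show 𝓕 u = fun w => fourier u ((2 * Real.pi) • w) from
      funext (fourierTransform_eq_fourier u)]
    exact hF.comp_smul (by positivity)
  have h := congrFun (hc.fourierInv_fourier_eq hi hF') y
  rw [← h, Real.fourierInv_eq']
  refine integral_congr_ae (Eventually.of_forall fun w => ?_)
  simp only [smul_eq_mul, inner_smul_right, fourierTransform_eq_fourier, real_inner_comm y w]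
  rw [mul_comm]
  congr 2
  push_cast
  ring

/-- The Fourier transform of the conjugate of a translate. -/
lemma integral_conj_translate_mul_exp (ψ : E d → ℂ) (x ξ : E d) :
    ∫ y : E d, (starRingEnd ℂ) (ψ (y - x)) *
        Complex.exp (Complex.I * ((inner ℝ y ξ : ℝ) : ℂ))
      = Complex.exp (Complex.I * ((inner ℝ x ξ : ℝ) : ℂ)) * (starRingEnd ℂ) (fourier ψ ξ) := by
  rw [fourier, ← integral_conj, ← integral_const_mul,
    ← integral_add_right_eq_self _ x]
  refine integral_congr_ae (Eventually.of_forall fun y => ?_)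
  simp only [add_sub_cancel_right, inner_add_left, map_mul, ← Complex.exp_conj, map_neg,
    Complex.conj_I, Complex.conj_ofReal, neg_mul, neg_neg, Complex.ofReal_add, mul_add,
    Complex.exp_add]
  ring

/-- The Gabor transform as a twisted convolution of the Fourier transforms. -/
lemma gabor_eq_integral_fourier {f ψ : E d → ℂ} (hc : Continuous f) (hi : Integrable f volume)
    (hF : Integrable (fourier f) volume) (hψ : Integrable ψ volume) (x ξ : E d) :
    gabor ψ f x ξ = ∫ w : E d, fourier f ((2 * Real.pi) • w) *
      (Complex.exp (Complex.I * ((inner ℝ x ((2 * Real.pi) • w - ξ) : ℝ) : ℂ)) *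
        (starRingEnd ℂ) (fourier ψ ((2 * Real.pi) • w - ξ))) := by
  have hψ' : Integrable (fun y => (starRingEnd ℂ) (ψ (y - x))) volume :=
    (Complex.conjCLE.toContinuousLinearMap.integrable_comp (hψ.comp_sub_right x))
  have hF' : Integrable (fun w => fourier f ((2 * Real.pi) • w)) volume :=
    hF.comp_smul (by positivity)
  calc gabor ψ f x ξ
      = ∫ y : E d, ∫ w : E d, (starRingEnd ℂ) (ψ (y - x)) * fourier f ((2 * Real.pi) • w) *
          Complex.exp (Complex.I * ((inner ℝ y ((2 * Real.pi) • w - ξ) : ℝ) : ℂ)) := by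
        refine integral_congr_ae (Eventually.of_forall fun y => ?_)
        simp only
        rw [integral_fourier_mul_exp f hc hi hF y, mul_assoc, ← integral_mul_const]
        refine integral_congr_ae (Eventually.of_forall fun w => ?_)
        simp only [inner_sub_right, Complex.ofReal_sub, mul_sub, Complex.exp_sub,
          Complex.exp_neg]
        ring
    _ = ∫ w : E d, ∫ y : E d, (starRingEnd ℂ) (ψ (y - x)) * fourier f ((2 * Real.pi) • w) *
          Complex.exp (Complex.I * ((inner ℝ y ((2 * Real.pi) • w - ξ) : ℝ) : ℂ)) := by
        refine integral_integral_swap ((hψ'.mul_prod hF').mul_bdd (c := 1) ?_ ?_)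
        · exact Continuous.aestronglyMeasurable (by fun_prop)
        · refine Eventually.of_forall fun z => ?_
          rw [mul_comm, Complex.norm_exp_ofReal_mul_I]
    _ = _ := by
        refine integral_congr_ae (Eventually.of_forall fun w => ?_)
        simp only
        rw [← integral_conj_translate_mul_exp, ← integral_const_mul]
        refine integral_congr_ae (Eventually.of_forall fun y => ?_)
        simp only
        ring

/-! ### Frequency support of the Gabor transform. -/

lemma ofReal_supNorm_le_supportRadius {g : E d → ℂ} {x : E d} (hx : g x ≠ 0) :
    ENNReal.ofReal (supNorm x) ≤ supportRadius g :=
  le_iSup₂ (f := fun x (_ : x ∈ tsupport g) => ENNReal.ofReal (supNorm x)) x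
    (subset_tsupport g hx)

lemma supNorm_nonneg (x : E d) : 0 ≤ supNorm x := norm_nonneg _

lemma supNorm_le_add (ξ η : E d) : supNorm ξ ≤ supNorm η + supNorm (η - ξ) := by
  simpa [supNorm] using norm_sub_le (WithLp.ofLp η) (WithLp.ofLp (η - ξ))

/-- The Gabor transform vanishes for frequencies outside the cube of radius `R_f̂ + R_ψ̂`. -/
lemma ofReal_supNorm_le_of_gabor_ne_zero {f ψ : E d → ℂ} (hc : Continuous f)
    (hi : Integrable f volume) (hF : Integrable (fourier f) volume) (hψ : Integrable ψ volume)
    {x ξ : E d} (h : gabor ψ f x ξ ≠ 0) :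
    ENNReal.ofReal (supNorm ξ) ≤ supportRadius (fourier f) + supportRadius (fourier ψ) := by
  by_contra hlt
  refine h ?_
  rw [gabor_eq_integral_fourier hc hi hF hψ]
  refine integral_eq_zero_of_ae (Eventually.of_forall fun w => ?_)
  simp only [Pi.zero_apply]
  by_contra hw
  have h1 : fourier f ((2 * Real.pi) • w) ≠ 0 := left_ne_zero_of_mul hw
  have h2 : fourier ψ ((2 * Real.pi) • w - ξ) ≠ 0 := fun h0 => hw (by simp [h0])
  refine hlt ?_
  calc ENNReal.ofReal (supNorm ξ)
      ≤ ENNReal.ofReal (supNorm ((2 * Real.pi) • w) + supNorm ((2 * Real.pi) • w - ξ)) :=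
        ENNReal.ofReal_le_ofReal (supNorm_le_add _ _)
    _ = _ := ENNReal.ofReal_add (supNorm_nonneg _) (supNorm_nonneg _)
    _ ≤ _ := add_le_add (ofReal_supNorm_le_supportRadius h1) (ofReal_supNorm_le_supportRadius h2)

/-! ### Spatial decay of the Gabor transform. -/

/-- The Gabor transform decays rapidly in the space variable, uniformly in the frequency. -/
lemma exists_norm_gabor_le (hω : IsWeight ω) {f ψ : E d → ℂ} (hf : f ∈ SOmega ω d)
    (hψ : ψ ∈ SOmega ω d) {l : ℝ} (hl : 0 ≤ l) :
    ∃ C : ℝ, 0 ≤ C ∧ ∀ x ξ, Real.exp (l * ω ‖x‖) * ‖gabor ψ f x ξ‖ ≤ C * polyDecay x := by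
  obtain ⟨L, hL, hadd⟩ := hω.exists_le_add d
  obtain ⟨s, K, hs, hK, hsK⟩ := hω.exists_exp_neg_mul_le_polyDecay d
  -- `L` offsets the loss in `exists_le_add`; `l` cancels the weight, and `s` yields `polyDecay x`.
  have hk : 0 ≤ (l + s) * L := by positivity
  obtain ⟨A, hA, hfA⟩ := SOmega.exists_norm_le hω hf hk
  obtain ⟨B, hB, hψB⟩ := SOmega.exists_norm_le hω hψ hk
  set k := (l + s) * L with hkdef
  have hI : 0 ≤ ∫ y : E d, polyDecay y := integral_nonneg fun y => (polyDecay_pos y).le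
  refine ⟨A * B * Real.exp k * (∫ y : E d, polyDecay y) * K, by positivity, fun x ξ => ?_⟩
  have hbound : ‖gabor ψ f x ξ‖
      ≤ ∫ y : E d, (A * B * Real.exp k * Real.exp (-((l + s) * ω ‖x‖))) * polyDecay y := by
    refine norm_integral_le_of_norm_le (integrable_polyDecay.const_mul _)
      (Eventually.of_forall fun y => ?_)
    have hexp : ‖Complex.exp (-(Complex.I * ((inner ℝ y ξ : ℝ) : ℂ)))‖ = 1 := by
      rw [show -(Complex.I * ((inner ℝ y ξ : ℝ) : ℂ)) = ((-inner ℝ y ξ : ℝ) : ℂ) * Complex.I by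
        push_cast; ring]
      exact Complex.norm_exp_ofReal_mul_I _
    rw [norm_mul, norm_mul, hexp, mul_one, RCLike.norm_conj]
    have hψ' : ‖ψ (y - x)‖ ≤ B * Real.exp (-(k * ω ‖y - x‖)) :=
      (hψB _).trans (mul_le_mul_of_nonneg_left
        (mul_le_of_le_one_right (Real.exp_pos _).le (polyDecay_le_one _)) hB)
    have he : Real.exp (-(k * ω ‖y‖)) * Real.exp (-(k * ω ‖y - x‖))
        ≤ Real.exp k * Real.exp (-((l + s) * ω ‖x‖)) := by
      rw [← Real.exp_add, ← Real.exp_add, Real.exp_le_exp]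
      have := mul_le_mul_of_nonneg_left (hadd x y) (by positivity : 0 ≤ l + s)
      rw [← mul_assoc, ← hkdef] at this
      linarith
    calc ‖f y‖ * ‖ψ (y - x)‖
        ≤ (A * (Real.exp (-(k * ω ‖y‖)) * polyDecay y)) * (B * Real.exp (-(k * ω ‖y - x‖))) :=
          mul_le_mul (hfA y) hψ' (norm_nonneg _)
            (mul_nonneg hA (mul_nonneg (Real.exp_pos _).le (polyDecay_pos y).le))
      _ = (A * B * polyDecay y) *
          (Real.exp (-(k * ω ‖y‖)) * Real.exp (-(k * ω ‖y - x‖))) := by ring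
      _ ≤ (A * B * polyDecay y) * (Real.exp k * Real.exp (-((l + s) * ω ‖x‖))) :=
          mul_le_mul_of_nonneg_left he (by have := (polyDecay_pos y).le; positivity)
      _ = _ := by ring
  rw [integral_const_mul] at hbound
  have hsplit : Real.exp (l * ω ‖x‖) * Real.exp (-((l + s) * ω ‖x‖))
      = Real.exp (-(s * ω ‖x‖)) := by
    rw [← Real.exp_add]; congr 1; ring
  calc Real.exp (l * ω ‖x‖) * ‖gabor ψ f x ξ‖
      ≤ Real.exp (l * ω ‖x‖) * _ := mul_le_mul_of_nonneg_left hbound (Real.exp_pos _).le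
    _ = A * B * Real.exp k * (∫ y : E d, polyDecay y) *
        (Real.exp (l * ω ‖x‖) * Real.exp (-((l + s) * ω ‖x‖))) := by ring
    _ ≤ A * B * Real.exp k * (∫ y : E d, polyDecay y) * (K * polyDecay x) := by
        rw [hsplit]
        exact mul_le_mul_of_nonneg_left (hsK x) (by positivity)
    _ = _ := by ring

/-! ### Mixed norm bounds and `N`-th roots. -/

lemma exists_norm_le_of_supNorm_le (d : ℕ) (R : ℝ) :
    ∃ r : ℝ, 0 ≤ r ∧ ∀ x : E d, supNorm x ≤ R → ‖x‖ ≤ r := by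
  refine ⟨√d * |R|, by positivity, fun x hx => ?_⟩
  rw [EuclideanSpace.norm_eq, ← Real.sqrt_sq_eq_abs, ← Real.sqrt_mul (by positivity)]
  refine Real.sqrt_le_sqrt ?_
  calc ∑ i, ‖x i‖ ^ 2 ≤ ∑ _i : Fin d, R ^ 2 :=
        Finset.sum_le_sum fun i _ =>
          pow_le_pow_left₀ (norm_nonneg _) ((norm_le_pi_norm (WithLp.ofLp x) i).trans hx) 2
    _ = d * R ^ 2 := by simp

/-- A mixed norm is controlled by a pointwise bound by a tensor product. -/
lemma mixedNorm_le {p q : ℝ≥0∞} {F : E d → E d → ℂ} {c : ℝ} (hc : 0 ≤ c) {g : E d → ℝ}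
    (hg : AEStronglyMeasurable g volume) (h : ∀ x ξ, ‖F x ξ‖ ≤ c * ‖g ξ‖ * ‖g x‖) :
    mixedNorm p q F ≤ ENNReal.ofReal c * (eLpNorm g p volume * eLpNorm g q volume) := by
  rw [← mul_assoc]
  refine eLpNorm_le_mul_eLpNorm_of_ae_le_mul'' q hg (Eventually.of_forall fun ξ => ?_)
  rw [enorm_eq_self, mul_right_comm, ← ofReal_norm (g ξ), ← ENNReal.ofReal_mul hc]
  exact eLpNorm_le_mul_eLpNorm_of_ae_le_mul (Eventually.of_forall fun x => h x ξ) p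

/-- The `N`-th root of a geometric bound. -/
lemma limsup_rpow_one_div_le {a : ℕ → ℝ≥0∞} {C R : ℝ≥0∞} (hC : C ≠ ∞) (hR : R ≠ ∞)
    (h : ∀ N : ℕ, N ≠ 0 → a N ≤ R ^ N * C) :
    limsup (fun N : ℕ => a N ^ (1 / (N : ℝ))) atTop ≤ R := by
  -- `C + 1` replaces `C` because the base must be nonzero for its `1/N`-th power to tend to 1.
  have hlim : Tendsto (fun N : ℕ => R * (C + 1) ^ (1 / (N : ℝ))) atTop (nhds R) := by
    have h1 : Tendsto (fun N : ℕ => (C + 1).toReal ^ (1 / (N : ℝ))) atTop (nhds 1) := by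
      have := (Real.continuousAt_const_rpow (a := (C + 1).toReal) (b := 0)
        (ENNReal.toReal_pos (by simp) (by finiteness)).ne').tendsto.comp
        tendsto_one_div_atTop_nhds_zero_nat
      simpa [Function.comp_def] using this
    have h2 := ENNReal.tendsto_ofReal h1
    simp only [ENNReal.ofReal_one] at h2
    have h3 := ENNReal.Tendsto.const_mul (a := R) h2 (Or.inr hR)
    rw [mul_one] at h3
    refine h3.congr fun N => ?_
    rw [← ENNReal.ofReal_rpow_of_nonneg ENNReal.toReal_nonneg (by positivity),
      ENNReal.ofReal_toReal (by finiteness)]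
  rw [← hlim.limsup_eq]
  refine limsup_le_limsup ?_
  filter_upwards [eventually_ne_atTop 0] with N hN
  calc a N ^ (1 / (N : ℝ)) ≤ (R ^ N * (C + 1)) ^ (1 / (N : ℝ)) := by
        refine ENNReal.rpow_le_rpow ((h N hN).trans ?_) (by positivity)
        gcongr
        exact le_self_add
    _ = R * (C + 1) ^ (1 / (N : ℝ)) := by
        rw [ENNReal.mul_rpow_of_nonneg _ _ (by positivity), ← ENNReal.rpow_natCast,
          ← ENNReal.rpow_mul, mul_one_div_cancel (by exact_mod_cast hN), ENNReal.rpow_one]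

end RealPaleyWiener

theorem proposition3p7 (d : ℕ) (ω : ℝ → ℝ) (hω : RealPaleyWiener.IsWeight ω)
    (f ψ : RealPaleyWiener.E d → ℂ)
    (hf : f ∈ RealPaleyWiener.SOmega ω d) (hψ : ψ ∈ RealPaleyWiener.SOmega ω d)
    (p q : ℝ≥0∞) (hp : 1 ≤ p) (hq : 1 ≤ q) (l m : ℝ) (hl : 0 ≤ l) (hm : 0 ≤ m) :
    limsup (fun N : ℕ =>
      RealPaleyWiener.mixedNorm p q (fun x ξ : RealPaleyWiener.E d =>
        ((Real.exp (l * ω ‖((N : ℝ) + 1)⁻¹ • x‖ + m * ω ‖ξ‖)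
            * RealPaleyWiener.supNorm ξ ^ N : ℝ) : ℂ)
          * RealPaleyWiener.gabor ψ f x ξ) ^ (1 / (N : ℝ))) atTop
      ≤ RealPaleyWiener.supportRadius (RealPaleyWiener.fourier f)
        + RealPaleyWiener.supportRadius (RealPaleyWiener.fourier ψ) := by
  open RealPaleyWiener in
  set R := supportRadius (fourier f) + supportRadius (fourier ψ) with hRdef
  rcases eq_or_ne R ∞ with hR | hR
  · rw [hR]; exact le_top
  obtain ⟨C, hC, hgab⟩ := exists_norm_gabor_le hω hf hψ hl
  obtain ⟨r, hr, hball⟩ := exists_norm_le_of_supNorm_le d R.toReal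
  -- The first factor bounds the weight on the ball of radius `r`; the second buys a factor
  -- `polyDecay ξ`, making the bound `L^q` in `ξ`.
  set P : ℝ := Real.exp (m * ω r) * (1 + r) ^ ((d : ℝ) + 1) with hP
  have hP0 : 0 ≤ P := by positivity
  have hG (s : ℝ≥0∞) (hs : 1 ≤ s) : eLpNorm (polyDecay (d := d)) s volume ≠ ∞ :=
    (memLp_polyDecay hs).eLpNorm_ne_top
  refine limsup_rpow_one_div_le (C := ENNReal.ofReal (P * C) *
    (eLpNorm (polyDecay (d := d)) p volume * eLpNorm (polyDecay (d := d)) q volume))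
    (ENNReal.mul_ne_top ENNReal.ofReal_ne_top (ENNReal.mul_ne_top (hG p hp) (hG q hq))) hR
    fun N _ => ?_
  have hRN : R ^ N = ENNReal.ofReal (R.toReal ^ N) := by
    rw [ENNReal.ofReal_pow ENNReal.toReal_nonneg, ENNReal.ofReal_toReal hR]
  have hRN0 : 0 ≤ R.toReal ^ N := pow_nonneg ENNReal.toReal_nonneg N
  rw [← mul_assoc, hRN, ← ENNReal.ofReal_mul hRN0]
  refine mixedNorm_le (by positivity) integrable_polyDecay.aestronglyMeasurable fun x ξ => ?_
  rw [Real.norm_of_nonneg (polyDecay_pos x).le, Real.norm_of_nonneg (polyDecay_pos ξ).le]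
  have hx0 := (polyDecay_pos x).le
  have hξ0 := (polyDecay_pos ξ).le
  by_cases hV : gabor ψ f x ξ = 0
  · rw [hV, mul_zero, norm_zero]; positivity
  have hξ : supNorm ξ ≤ R.toReal := (ENNReal.ofReal_le_iff_le_toReal hR).1
    (ofReal_supNorm_le_of_gabor_ne_zero hf.2.1.continuous hf.1
      (SOmega.integrable_fourier hω hf) hψ.1 hV)
  have hξr := hball ξ hξ
  have hωξ : Real.exp (m * ω ‖ξ‖) ≤ P * polyDecay ξ := by
    calc Real.exp (m * ω ‖ξ‖) ≤ Real.exp (m * ω r) * 1 := by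
          rw [mul_one, Real.exp_le_exp]
          exact mul_le_mul_of_nonneg_left (hω.monotoneOn (norm_nonneg ξ) hr hξr) hm
      _ ≤ Real.exp (m * ω r) * ((1 + r) ^ ((d : ℝ) + 1) * polyDecay ξ) :=
          mul_le_mul_of_nonneg_left (one_le_mul_polyDecay hξr) (Real.exp_pos _).le
      _ = _ := by rw [hP, mul_assoc]
  have hωx : Real.exp (l * ω ‖((N : ℝ) + 1)⁻¹ • x‖) ≤ Real.exp (l * ω ‖x‖) := by
    rw [Real.exp_le_exp]
    refine mul_le_mul_of_nonneg_left (hω.monotoneOn (norm_nonneg _) (norm_nonneg _) ?_) hl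
    rw [norm_smul, Real.norm_of_nonneg (by positivity)]
    exact mul_le_of_le_one_left (norm_nonneg x)
      (inv_le_one_of_one_le₀ (by linarith [N.cast_nonneg (α := ℝ)]))
  rw [norm_mul, Complex.norm_real, Real.norm_of_nonneg
    (mul_nonneg (Real.exp_pos _).le (pow_nonneg (supNorm_nonneg ξ) N)), Real.exp_add]
  calc Real.exp (l * ω ‖((N : ℝ) + 1)⁻¹ • x‖) * Real.exp (m * ω ‖ξ‖) * supNorm ξ ^ N
        * ‖gabor ψ f x ξ‖
      = Real.exp (m * ω ‖ξ‖) * supNorm ξ ^ N *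
        (Real.exp (l * ω ‖((N : ℝ) + 1)⁻¹ • x‖) * ‖gabor ψ f x ξ‖) := by ring
    _ ≤ (P * polyDecay ξ * R.toReal ^ N) * (C * polyDecay x) := by
        refine mul_le_mul (mul_le_mul hωξ (pow_le_pow_left₀ (supNorm_nonneg ξ) hξ N)
          (pow_nonneg (supNorm_nonneg ξ) N) (by positivity)) ?_ (by positivity) (by positivity)
        exact (mul_le_mul_of_nonneg_right hωx (norm_nonneg _)).trans (hgab x ξ)
    _ = _ := by ring
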